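/- Let $R$ be a commutative Noetherian local ring and let $M$ be a finitely generated $R$-module. A \emph{quasi-deformation} of $R$ is a diagram $R \to R' \leftarrow Q$ of local homomorphisms of Noetherian local rings in which $R'$ is flat over $R$ and $Q \to R'$ is surjective with kernel generated by a (possibly empty) $Q$-regular sequence. For an $R$-module $N$ set $$\operatorname{CI-dim}_R(N)=\inf\{\operatorname{pd}_Q(R'\otimes_R N)-\operatorname{pd}_Q(R') \mid R\to R'\leftarrow Q \text{ is a quasi-deformation}\}$$ (where $\operatorname{pd}_Q(0)=-\infty$) and $$\operatorname{grade}(N)=\inf\{i\ge 0 \mid \operatorname{Ext}^i_R(N,R)\neq 0\}$$ (with $\inf\emptyset=\infty$). The module $N$ is called \emph{CI-perfect} if $\operatorname{CI-dim}_R(N)=\operatorname{grade}(N)$, and \emph{CI-perfect of grade $g$} if moreover $\operatorname{grade}(N)=g$. Let $g\ge 0$ be an integer. If $M$ is CI-perfect of grade $g$, then $\operatorname{Ext}^g_R(M,R)$ is CI-perfect of grade $g$. -/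

import Mathlib

universe u

open CategoryTheory TensorProduct

/-- A quasi-deformation `R ⟶ S ⟵ Q` of a local ring `R`: a diagram of local homomorphisms of
Noetherian local rings in which `S` is flat over `R`, and `Q ⟶ S` is surjective with kernel
generated by a (possibly empty) `Q`-regular sequence. -/
structure QuasiDeformation (R : Type u) [CommRing R] where
  /-- the flat extension of `R` -/
  S : Type u
  /-- the ring of which `S` is a quotient -/
  Q : Type u
  [commRingS : CommRing S]
  [commRingQ : CommRing Q]
  [isLocalRingS : IsLocalRing S]
  [isLocalRingQ : IsLocalRing Q]
  [isNoetherianRingS : IsNoetherianRing S]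
  [isNoetherianRingQ : IsNoetherianRing Q]
  [algebraRS : Algebra R S]
  [algebraQS : Algebra Q S]
  [isLocalHomRS : IsLocalHom (algebraMap R S)]
  [isLocalHomQS : IsLocalHom (algebraMap Q S)]
  [flat : Module.Flat R S]
  surjective : Function.Surjective (algebraMap Q S)
  exists_regular : ∃ rs : List Q,
    RingTheory.Sequence.IsRegular Q rs ∧ RingHom.ker (algebraMap Q S) = Ideal.ofList rs

namespace QuasiDeformation

attribute [instance] commRingS commRingQ isLocalRingS isLocalRingQ isNoetherianRingS
  isNoetherianRingQ algebraRS algebraQS isLocalHomRS isLocalHomQS flat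

variable {R : Type u} [CommRing R] (D : QuasiDeformation R)

/-- The actions of `R` and `Q` on `S` commute, so that `Q` acts on `S ⊗[R] M` through `S`. -/
instance smulCommClass : SMulCommClass R D.Q D.S where
  smul_comm r q s := by
    simp only [Algebra.smul_def]
    exact mul_left_comm _ _ _

end QuasiDeformation

/-- The projective dimension `pd_A N` as an extended real number: it is `⊥` for `N = 0`, `⊤` if
there is no finite projective resolution, and a natural number otherwise. -/
noncomputable def extendedPd (A : Type u) [CommRing A] (N : Type u) [AddCommGroup N] [Module A N] :
    EReal :=
  match projectiveDimension (ModuleCat.of A N) with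
  | ⊥ => ⊥
  | (n : ℕ∞) => ((n : ENNReal) : EReal)

/-- The complete intersection dimension of an `R`-module `M`: the infimum of
`pd_Q (S ⊗[R] M) - pd_Q S` over all quasi-deformations `R ⟶ S ⟵ Q`. As `S` is flat over `R`,
the derived tensor product of `S` and `M` is the ordinary one. Note that `pd_Q S` is always
a natural number (the length of the regular sequence). -/
noncomputable def ciDim (R : Type u) [CommRing R] (M : Type u) [AddCommGroup M] [Module R M] :
    EReal :=
  ⨅ D : QuasiDeformation R, extendedPd D.Q (D.S ⊗[R] M) - extendedPd D.Q D.S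

/-- `Ext^i_R(M, R)`, with its `R`-module structure. -/
abbrev ExtRing (R : Type u) [CommRing R] (M : Type u) [AddCommGroup M] [Module R M] (i : ℕ) :
    Type u :=
  Abelian.Ext.{u} (ModuleCat.of R M) (ModuleCat.of R R) i

/-- The grade of a module: the infimum of the `i` with `Ext^i_R(M, R) ≠ 0` (`⊤` if there is
no such `i`). -/
noncomputable def moduleGrade (R : Type u) [CommRing R] (M : Type u) [AddCommGroup M]
    [Module R M] : ℕ∞ :=
  ⨅ (i : ℕ) (_ : Nontrivial (ExtRing R M i)), (i : ℕ∞)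

/-- `M` is CI-perfect if its complete intersection dimension equals its grade. -/
def IsCIPerfect (R : Type u) [CommRing R] (M : Type u) [AddCommGroup M] [Module R M] : Prop :=
  ciDim R M = ((moduleGrade R M : ENNReal) : EReal)

/-- `M` is CI-perfect of grade `g`. -/
def IsCIPerfectOfGrade (R : Type u) [CommRing R] (M : Type u) [AddCommGroup M] [Module R M]
    (g : ℕ) : Prop :=
  IsCIPerfect R M ∧ moduleGrade R M = g

/-!
A quasi-deformation `R → S ← Q`, where a regular sequence of length `c` generates the kernel of
`Q → S`, translates statements about a finitely generated `R`-module `M` into statements about the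
`Q`-module `S ⊗ M`, because `S ⊗ Ext^i_R(M, R) ≃ Ext^{c+i}_Q(S ⊗ M, Q)`
(`QuasiDeformation.nonempty_tensor_ext_equiv`) and `Ext^j_Q(S ⊗ M, Q) = 0` for `j < c`
(`subsingleton_ext_of_isWeaklyRegular`). The isomorphism combines flat base change with Rees's
isomorphism `Hom_Q(-, S) ≃ Ext^c_Q(-, Q)` on modules over `S`, which is composition with one class
(`exists_ext_comp_bijective`) and therefore natural. As `S` is faithfully flat over `R`, the grade
of `S ⊗ M` over `Q` is `grade M + c`, while `pd_Q S = c`. In particular `grade ≤ CI-dim` always holds.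

If `M` is CI-perfect of grade `g`, some quasi-deformation attains the infimum defining the complete
intersection dimension, and `L = S ⊗ M` is perfect over `Q`: its grade and its projective dimension
are both `n = c + g`. It remains to see that `E = Ext^n_Q(L, Q) ≃ S ⊗ Ext^g_R(M, R)` is perfect of
grade `n` as well.
* Dualizing a projective resolution of `L` of length `n` gives one of `E`, so `pd E ≤ n`
  (`hasProjectiveDimensionLT_ext_of_perfect`).
* The annihilator of `E` contains that of `L`, which by Rees's theorem contains a regular sequence
  of length `n`, so `Ext^i(E, Q) = 0` for `i < n` (`subsingleton_ext_of_annihilator_le`).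
* A nonzero finitely generated module of projective dimension at most `n` has some
  `Ext^i(E, Q) ≠ 0` with `i ≤ n`, so `Ext^n(E, Q) ≠ 0`
  (`nontrivial_ext_of_hasProjectiveDimensionLT`).
-/

open Abelian RingTheory.Sequence

/-! ### Regular sequences and vanishing of `Ext` -/

lemma ext_smul_eq_zero_of_mem_annihilator_left {A : Type u} [CommRing A] {L N : ModuleCat.{u} A}
    {n : ℕ} {r : A} (hr : r ∈ Module.annihilator A L) (x : Ext L N n) : r • x = 0 := by
  have h0 : r • 𝟙 L = 0 := by
    ext y
    exact Module.mem_annihilator.mp hr y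
  calc r • x = (Ext.mk₀ (r • 𝟙 L)).comp x (zero_add n) := by simp [Ext.mk₀_smul]
    _ = 0 := by rw [h0, Ext.mk₀_zero, Ext.zero_comp]

/-- On modules killed by `r`, the first map of `0 → N → N → N/rN → 0` induces zero on `Ext`, so the
covariant long exact sequence breaks into short pieces. -/
lemma ext_comp_smulShortComplex_f {A : Type u} [CommRing A] {L N : ModuleCat.{u} A}
    {n : ℕ} {r : A} (hr : r ∈ Module.annihilator A L) (x : Ext L N n) :
    x.comp (Ext.mk₀ (N.smulShortComplex r).f) (add_zero n) = 0 := by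
  have h : x.comp (Ext.mk₀ (r • 𝟙 N)) (add_zero n) = r • x := by simp [Ext.mk₀_smul]
  exact h.trans (ext_smul_eq_zero_of_mem_annihilator_left hr x)

lemma subsingleton_ext_X₁_succ {A : Type u} [CommRing A] {S : ShortComplex (ModuleCat.{u} A)}
    (hS : S.ShortExact) (L : ModuleCat.{u} A) {n : ℕ}
    (hf : ∀ x : Ext L S.X₁ (n + 1), x.comp (Ext.mk₀ S.f) (add_zero _) = 0)
    (h : Subsingleton (Ext L S.X₃ n)) : Subsingleton (Ext L S.X₁ (n + 1)) := by
  refine subsingleton_of_forall_eq 0 fun x => ?_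
  obtain ⟨y, rfl⟩ := Ext.covariant_sequence_exact₁ L hS x (hf x) rfl
  rw [h.elim y 0, Ext.zero_comp]

lemma bijective_comp_extClass {A : Type u} [CommRing A] {S : ShortComplex (ModuleCat.{u} A)}
    (hS : S.ShortExact) (L : ModuleCat.{u} A) {n : ℕ}
    (hf : ∀ x : Ext L S.X₁ (n + 1), x.comp (Ext.mk₀ S.f) (add_zero _) = 0)
    (h : Subsingleton (Ext L S.X₂ n)) :
    Function.Bijective (fun x : Ext L S.X₃ n => x.comp hS.extClass (rfl : n + 1 = n + 1)) := by
  constructor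
  · intro x y hxy
    have h0 : (x - y).comp hS.extClass (rfl : n + 1 = n + 1) = 0 := by
      rw [sub_eq_add_neg, Ext.add_comp, Ext.neg_comp, ← sub_eq_add_neg, sub_eq_zero]
      exact hxy
    obtain ⟨z, hz⟩ := Ext.covariant_sequence_exact₃ L hS (x - y) rfl h0
    rw [h.elim z 0, Ext.zero_comp] at hz
    exact sub_eq_zero.mp hz.symm
  · intro x
    exact Ext.covariant_sequence_exact₁ L hS x (hf x) rfl

lemma subsingleton_ext_X₃ {A : Type u} [CommRing A] {S : ShortComplex (ModuleCat.{u} A)}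
    (hS : S.ShortExact) (L : ModuleCat.{u} A) {n : ℕ} (h₂ : Subsingleton (Ext L S.X₂ n))
    (h₁ : Subsingleton (Ext L S.X₁ (n + 1))) : Subsingleton (Ext L S.X₃ n) := by
  refine subsingleton_of_forall_eq 0 fun x => ?_
  obtain ⟨y, rfl⟩ := Ext.covariant_sequence_exact₃ L hS x rfl (h₁.elim _ _)
  rw [h₂.elim y 0, Ext.zero_comp]

/-- The easy half of Rees's theorem: `Ext` from a module killed by a weakly `N`-regular sequence
into `N` vanishes below the length of the sequence. -/
theorem subsingleton_ext_of_isWeaklyRegular {A : Type u} [CommRing A] (rs : List A)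
    (N : ModuleCat.{u} A) (hrs : IsWeaklyRegular N rs) (L : ModuleCat.{u} A)
    (hL : ∀ r ∈ rs, r ∈ Module.annihilator A L) (j : ℕ) (hj : j < rs.length) :
    Subsingleton (Ext L N j) := by
  induction rs generalizing N j with
  | nil => simp at hj
  | cons r rs ih =>
    rw [isWeaklyRegular_cons_iff] at hrs
    have hS := hrs.1.smulShortComplex_shortExact
    have hf {n : ℕ} (x : Ext L N n) := ext_comp_smulShortComplex_f (hL r (by simp)) x
    cases j with
    | zero =>
      have := hS.mono_f
      refine subsingleton_of_forall_eq 0 fun x => ?_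
      exact Ext.postcomp_mk₀_injective_of_mono L (N.smulShortComplex r).f
        ((hf x).trans (map_zero ((Ext.mk₀ (N.smulShortComplex r).f).postcomp L (add_zero 0))).symm)
    | succ j =>
      exact subsingleton_ext_X₁_succ hS L hf
        (ih (ModuleCat.of A (QuotSMulTop r N)) hrs.2 (fun s hs => hL s (by simp [hs])) j
          (by simpa using hj))

lemma bijective_comp_iso_hom {C : Type*} [Category C] (L : C) {X Y : C} (e : X ≅ Y) :
    Function.Bijective (fun f : L ⟶ X => f ≫ e.hom) :=
  ⟨fun f g h => by simpa using h, fun f => ⟨f ≫ e.inv, by simp⟩⟩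

/-- If `rs` is a weakly `N`-regular sequence of length `c`, then `Hom(-, N/rsN)` and `Ext^c(-, N)`
agree on modules killed by `rs`. The isomorphism is composition with one class `η`, an iterated
product of the classes of the extensions `0 → N → N → N/rN → 0`, so it is natural. -/
theorem exists_ext_comp_bijective {A : Type u} [CommRing A] (rs : List A)
    (N : ModuleCat.{u} A) (hrs : IsWeaklyRegular N rs) :
    ∃ η : Ext (ModuleCat.of A (N ⧸ (Ideal.ofList rs • (⊤ : Submodule A N)))) N rs.length,
      ∀ L : ModuleCat.{u} A, (∀ r ∈ rs, r ∈ Module.annihilator A L) →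
        Function.Bijective (fun f : L ⟶ ModuleCat.of A
          (N ⧸ (Ideal.ofList rs • (⊤ : Submodule A N))) => (Ext.mk₀ f).comp η (zero_add _)) := by
  induction rs generalizing N with
  | nil =>
    let e : ModuleCat.of A (N ⧸ (Ideal.ofList ([] : List A) • (⊤ : Submodule A N))) ≅ N :=
      (Submodule.quotEquivOfEqBot _ (by simp)).toModuleIso
    refine ⟨Ext.mk₀ e.hom, fun L _ => ?_⟩
    have : (fun f : L ⟶ _ => (Ext.mk₀ f).comp (Ext.mk₀ e.hom) (zero_add _)) =
        Ext.mk₀ ∘ fun f => f ≫ e.hom := by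
      funext f
      simp
    exact this ▸ (Ext.mk₀_bijective _ _).comp (bijective_comp_iso_hom L e)
  | cons r rs ih =>
    have hrs' := hrs
    rw [isWeaklyRegular_cons_iff] at hrs'
    have hS := hrs'.1.smulShortComplex_shortExact
    obtain ⟨η, hη⟩ := ih (ModuleCat.of A (QuotSMulTop r N)) hrs'.2
    let e := (Submodule.quotOfListConsSMulTopEquivQuotSMulTopInner N r rs).toModuleIso
    refine ⟨((Ext.mk₀ e.hom).comp η (zero_add _)).comp hS.extClass rfl, fun L hL => ?_⟩
    have hb := bijective_comp_extClass hS L (n := rs.length)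
      (ext_comp_smulShortComplex_f (hL r (by simp)))
      (subsingleton_ext_of_isWeaklyRegular (r :: rs) N hrs L hL rs.length (by simp))
    -- `f ↦ f ∘ η` factors through the isomorphism `N/(r, rs)N ≃ (N/rN)/rs(N/rN)`, the class `η` of
    -- the shorter sequence, and the connecting map, which are all bijective.
    have key : (fun f : L ⟶ ModuleCat.of A
          (N ⧸ (Ideal.ofList (r :: rs) • (⊤ : Submodule A N))) => (Ext.mk₀ f).comp
          (((Ext.mk₀ e.hom).comp η (zero_add _)).comp hS.extClass rfl) (zero_add _)) =
        (fun x : Ext L (N.smulShortComplex r).X₃ rs.length => x.comp hS.extClass rfl) ∘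
          (fun f => (Ext.mk₀ f).comp η (zero_add _)) ∘ (fun f => f ≫ e.hom) := by
      funext f
      have h1 : (Ext.mk₀ (f ≫ e.hom)).comp η (zero_add _) =
          (Ext.mk₀ f).comp ((Ext.mk₀ e.hom).comp η (zero_add _)) (zero_add _) := by
        rw [← Ext.mk₀_comp_mk₀_assoc]
      exact (Ext.comp_assoc (Ext.mk₀ f) ((Ext.mk₀ e.hom).comp η (zero_add _)) hS.extClass
        (zero_add _) rfl (by omega)).symm.trans (congrArg (fun x : Ext L
          (N.smulShortComplex r).X₃ rs.length => x.comp hS.extClass rfl) h1.symm)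
    exact key ▸ hb.comp ((hη L fun s hs => hL s (by simp [hs])).comp (bijective_comp_iso_hom L e))

/-! ### Annihilators and grade -/

/-- The hard half of Rees's theorem: vanishing of `Ext` into `N` below degree `n` produces a weakly
`N`-regular sequence of length `n` in the annihilator. -/
theorem exists_isWeaklyRegular_of_subsingleton_ext {A : Type u} [CommRing A] [IsNoetherianRing A]
    (n : ℕ) (L N : ModuleCat.{u} A) [Module.Finite A L] [Module.Finite A N]
    (h : ∀ i < n, Subsingleton (Ext L N i)) :
    ∃ rs : List A, rs.length = n ∧ IsWeaklyRegular N rs ∧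
      ∀ r ∈ rs, r ∈ Module.annihilator A L := by
  induction n generalizing N with
  | zero => exact ⟨[], by simp⟩
  | succ n ih =>
    have h0 : Subsingleton (L →ₗ[A] N) := by
      have := h 0 (by omega)
      exact ((Ext.linearEquiv₀ (R := A)).trans ModuleCat.homLinearEquiv).symm.toEquiv.subsingleton
    obtain ⟨r, hr, hreg⟩ := (IsSMulRegular.subsingleton_linearMap_iff (M := N) (N := L)).mp h0
    have hS := hreg.smulShortComplex_shortExact
    obtain ⟨rs, hlen, hrs, hann⟩ := ih (ModuleCat.of A (QuotSMulTop r N)) fun i hi =>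
      subsingleton_ext_X₃ hS L (h i (by omega)) (h (i + 1) (by omega))
    refine ⟨r :: rs, by simp [hlen], (isWeaklyRegular_cons_iff _ _ _).mpr ⟨hreg, hrs⟩, ?_⟩
    simpa [hr] using hann

/-- The grade of a module depends only on its annihilator, so it can only grow when the annihilator
does. -/
theorem subsingleton_ext_of_annihilator_le {A : Type u} [CommRing A] [IsNoetherianRing A]
    {n : ℕ} {L N X : ModuleCat.{u} A} [Module.Finite A L] [Module.Finite A N]
    (h : ∀ i < n, Subsingleton (Ext L N i))
    (hX : Module.annihilator A L ≤ Module.annihilator A X) {i : ℕ} (hi : i < n) :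
    Subsingleton (Ext X N i) := by
  obtain ⟨rs, rfl, hrs, hann⟩ := exists_isWeaklyRegular_of_subsingleton_ext n L N h
  exact subsingleton_ext_of_isWeaklyRegular rs N hrs X (fun r hr => hX (hann r hr)) i hi

theorem subsingleton_ext_free {A : Type u} [CommRing A] {X : ModuleCat.{u} A} {m : ℕ}
    (h : Subsingleton (Ext X (ModuleCat.of A A) m)) (k : ℕ) :
    Subsingleton (Ext X (ModuleCat.of A (Fin k → A)) m) := by
  refine subsingleton_of_forall_eq 0 fun x => ?_
  have hid : 𝟙 (ModuleCat.of A (Fin k → A)) = ∑ i : Fin k,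
      (ModuleCat.ofHom (LinearMap.proj i) : ModuleCat.of A (Fin k → A) ⟶ ModuleCat.of A A) ≫
        ModuleCat.ofHom (LinearMap.single A (fun _ : Fin k => A) i) := by
    ext v j
    simp [ModuleCat.hom_sum, Finset.sum_apply, Pi.single_apply]
  rw [← Ext.comp_mk₀_id x, hid, Ext.mk₀_sum, Ext.comp_sum]
  refine Finset.sum_eq_zero fun i _ => ?_
  rw [← Ext.mk₀_comp_mk₀, ← Ext.comp_assoc_of_third_deg_zero]
  have : x.comp (Ext.mk₀ (ModuleCat.ofHom (LinearMap.proj i) :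
    ModuleCat.of A (Fin k → A) ⟶ ModuleCat.of A A)) (add_zero m) = 0 := h.elim _ _
  rw [this, Ext.zero_comp]

/-- For a module of projective dimension at most `m` the functor `Ext^m` is right exact in its second
argument, so it suffices to test its vanishing on the ring. -/
theorem hasProjectiveDimensionLT_of_subsingleton_ext {A : Type u} [CommRing A] [IsNoetherianRing A]
    {X : ModuleCat.{u} A} [Module.Finite A X] {m : ℕ} (hX : HasProjectiveDimensionLT X (m + 1))
    (h : Subsingleton (Ext X (ModuleCat.of A A) m)) : HasProjectiveDimensionLT X m := by
  refine ModuleCat.hasProjectiveDimensionLT_of_forall_finite X m fun N _ => ?_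
  obtain ⟨k, f, hf⟩ := Module.Finite.exists_fin' A N
  have hS := LinearMap.shortExact_shortComplexKer hf
  exact subsingleton_ext_X₃ hS X (subsingleton_ext_free h k)
    (HasProjectiveDimensionLT.subsingleton X (m + 1) (m + 1) le_rfl _)

theorem nontrivial_ext_of_hasProjectiveDimensionLT {A : Type u} [CommRing A] [IsNoetherianRing A]
    {X : ModuleCat.{u} A} [Module.Finite A X] [Nontrivial X] {n : ℕ}
    (hX : HasProjectiveDimensionLT X (n + 1))
    (h : ∀ i < n, Subsingleton (Ext X (ModuleCat.of A A) i)) :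
    Nontrivial (Ext X (ModuleCat.of A A) n) := by
  by_contra hn
  rw [not_nontrivial_iff_subsingleton] at hn
  -- Otherwise the bound on the projective dimension could be lowered until `X = 0`.
  have key : ∀ m ≤ n + 1, HasProjectiveDimensionLT X m := by
    intro m hm
    induction hm using Nat.decreasingInduction with
    | self => exact hX
    | of_succ k hk ih =>
      refine hasProjectiveDimensionLT_of_subsingleton_ext ih ?_
      rcases Nat.lt_or_ge k n with h' | h'
      · exact h k h'
      · obtain rfl : k = n := by omega
        exact hn
  have := (hasProjectiveDimensionLT_zero_iff_isZero X).mp (key 0 (by omega))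
  rw [ModuleCat.isZero_iff_subsingleton] at this
  exact not_subsingleton X this

/-! ### The dual of a perfect module -/

section DimensionShifting

variable {A : Type u} [CommRing A] {S : ShortComplex (ModuleCat.{u} A)}

lemma exact_precomp_g_precomp_f (hS : S.ShortExact) (Y : ModuleCat.{u} A) (n : ℕ) :
    Function.Exact ((Ext.mk₀ S.g).precompOfLinear A Y (zero_add n))
      ((Ext.mk₀ S.f).precompOfLinear A Y (zero_add n)) := by
  intro x
  refine ⟨fun hx => Ext.contravariant_sequence_exact₂ hS Y x hx, ?_⟩
  rintro ⟨y, rfl⟩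
  change (Ext.mk₀ S.f).comp ((Ext.mk₀ S.g).comp y (zero_add n)) (zero_add n) = 0
  rw [Ext.mk₀_comp_mk₀_assoc, S.zero, Ext.mk₀_zero, Ext.zero_comp]

lemma exact_precomp_f_precomp_extClass (hS : S.ShortExact) (Y : ModuleCat.{u} A) (n : ℕ) :
    Function.Exact ((Ext.mk₀ S.f).precompOfLinear A Y (zero_add n))
      (hS.extClass.precompOfLinear A Y (add_comm 1 n)) := by
  intro x
  refine ⟨fun hx => Ext.contravariant_sequence_exact₁ hS Y x (add_comm 1 n) hx, ?_⟩
  rintro ⟨y, rfl⟩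
  change hS.extClass.comp ((Ext.mk₀ S.f).comp y (zero_add n)) (add_comm 1 n) = 0
  simp

lemma precomp_g_injective (hS : S.ShortExact) (Y : ModuleCat.{u} A) :
    Function.Injective ((Ext.mk₀ S.g).precompOfLinear A Y (zero_add 0)) :=
  have := hS.epi_g
  Ext.precomp_mk₀_injective_of_epi Y S.g

lemma precomp_extClass_surjective (hS : S.ShortExact) (Y : ModuleCat.{u} A) (n : ℕ)
    (h : Subsingleton (Ext S.X₂ Y (n + 1))) :
    Function.Surjective (hS.extClass.precompOfLinear A Y (add_comm 1 n)) :=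
  fun x => Ext.contravariant_sequence_exact₃ hS Y x (h.elim _ _) (add_comm 1 n)

/-- Dimension shifting: the connecting homomorphism is an isomorphism if the adjacent `Ext` of
the middle term vanish. -/
noncomputable def extDimensionShift (hS : S.ShortExact) (Y : ModuleCat.{u} A) (n : ℕ)
    (h : Subsingleton (Ext S.X₂ Y n)) (h' : Subsingleton (Ext S.X₂ Y (n + 1))) :
    Ext S.X₁ Y n ≃ₗ[A] Ext S.X₃ Y (n + 1) :=
  LinearEquiv.ofBijective (hS.extClass.precompOfLinear A Y (add_comm 1 n))
    ⟨(injective_iff_map_eq_zero _).mpr fun x hx => by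
      obtain ⟨y, rfl⟩ := (exact_precomp_f_precomp_extClass hS Y n x).mp hx
      rw [h.elim y 0, map_zero], precomp_extClass_surjective hS Y n h'⟩

lemma hasProjectiveDimensionLT_of_exact {X Y Z : Type u} [AddCommGroup X] [AddCommGroup Y]
    [AddCommGroup Z] [Module A X] [Module A Y] [Module A Z] {f : X →ₗ[A] Y} {g : Y →ₗ[A] Z}
    (hf : Function.Injective f) (hfg : Function.Exact f g) (hg : Function.Surjective g) {n : ℕ}
    (hX : HasProjectiveDimensionLT (ModuleCat.of A X) n)
    (hY : HasProjectiveDimensionLT (ModuleCat.of A Y) (n + 1)) :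
    HasProjectiveDimensionLT (ModuleCat.of A Z) (n + 1) := by
  let T : ShortComplex (ModuleCat.{u} A) :=
    ShortComplex.mk (ModuleCat.ofHom f) (ModuleCat.ofHom g) (by
      ext x
      exact hfg.apply_apply_eq_zero x)
  have hT : T.ShortExact := ModuleCat.shortComplex_shortExact T hfg hf hg
  exact hT.hasProjectiveDimensionLT_X₃ n hX hY

lemma projective_ext_zero (P : ModuleCat.{u} A) [Module.Finite A P] [Module.Projective A P] :
    Module.Projective A (Ext P (ModuleCat.of A A) 0) :=
  .of_equiv' ((Ext.linearEquiv₀ (R := A)).trans ModuleCat.homLinearEquiv).symm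

lemma hasProjectiveDimensionLT_ext_zero (P : ModuleCat.{u} A) [Module.Finite A P]
    [Module.Projective A P] (n : ℕ) :
    HasProjectiveDimensionLT (ModuleCat.of A (Ext P (ModuleCat.of A A) 0)) (n + 1) := by
  have := projective_ext_zero P
  have := (IsProjective.iff_projective _).mp this
  exact hasProjectiveDimensionLT_of_ge _ 1 (n + 1) (by omega)

/-- If `Ext^i(K, A) = 0` strictly between `0` and `m + 1 ≥ pd K`, then dualizing a projective
resolution of `K` of length `m + 1` shows that the dual of `K` is a syzygy of order `m + 2` of
`Ext^{m+1}(K, A)`, up to projective summands. This bounds the projective dimension of the latter. -/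
theorem hasProjectiveDimensionLT_ext [IsNoetherianRing A] (m d : ℕ) (K : ModuleCat.{u} A)
    [Module.Finite A K] (hK : HasProjectiveDimensionLT K (m + 2))
    (h : ∀ i, 0 < i → i < m + 1 → Subsingleton (Ext K (ModuleCat.of A A) i))
    (hd : HasProjectiveDimensionLT (ModuleCat.of A (Ext K (ModuleCat.of A A) 0)) d) :
    HasProjectiveDimensionLT (ModuleCat.of A (Ext K (ModuleCat.of A A) (m + 1))) (d + m + 2) := by
  induction m generalizing d K with
  | zero =>
    obtain ⟨k, f, hf⟩ := Module.Finite.exists_fin' A K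
    have hS := LinearMap.shortExact_shortComplexKer hf
    have : Projective (ModuleCat.of A (Fin k → A)) := inferInstance
    have hK₁ := (hS.hasProjectiveDimensionLT_X₃_iff 0 this).mp hK
    have hP : Module.Projective A (LinearMap.ker f) :=
      (IsProjective.iff_projective _).mpr
        (projective_iff_hasProjectiveDimensionLT_one.mpr hK₁)
    let ρ := (Ext.mk₀ f.shortComplexKer.f).precompOfLinear A (ModuleCat.of A A) (zero_add 0)
    -- The dual sequence `0 → K* → P* → K₁* → Ext^1(K, A) → 0` is cut at the image of `P* → K₁*`.
    have h1 : HasProjectiveDimensionLT (ModuleCat.of A (LinearMap.range ρ)) (d + 1) :=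
      hasProjectiveDimensionLT_of_exact (precomp_g_injective hS (ModuleCat.of A A))
        (g := ρ.rangeRestrict) (fun x => by
          rw [← exact_precomp_g_precomp_f hS (ModuleCat.of A A) 0 x]
          exact Subtype.ext_iff) ρ.surjective_rangeRestrict hd
        (hasProjectiveDimensionLT_ext_zero (ModuleCat.of A (Fin k → A)) d)
    refine hasProjectiveDimensionLT_of_exact (LinearMap.range ρ).injective_subtype
      (g := hS.extClass.precompOfLinear A (ModuleCat.of A A) (add_comm 1 0)) (fun x => ?_)
      (precomp_extClass_surjective hS _ 0 (Ext.subsingleton_of_projective _ _ 0)) h1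
      (hasProjectiveDimensionLT_ext_zero (ModuleCat.of A (LinearMap.ker f)) (d + 1))
    rw [exact_precomp_f_precomp_extClass hS (ModuleCat.of A A) 0 x]
    simp [ρ]
  | succ m ih =>
    obtain ⟨k, f, hf⟩ := Module.Finite.exists_fin' A K
    have hS := LinearMap.shortExact_shortComplexKer hf
    have : Projective (ModuleCat.of A (Fin k → A)) := inferInstance
    have hK₁ := (hS.hasProjectiveDimensionLT_X₃_iff (m + 1) this).mp hK
    have e (i : ℕ) := extDimensionShift hS (ModuleCat.of A A) (i + 1)
      (Ext.subsingleton_of_projective _ _ i) (Ext.subsingleton_of_projective _ _ (i + 1))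
    -- As `Ext^1(K, A) = 0`, the dual sequence `0 → K* → P* → K₁* → 0` is exact.
    have hd₁ : HasProjectiveDimensionLT
        (ModuleCat.of A (Ext f.shortComplexKer.X₁ (ModuleCat.of A A) 0)) (d + 1) :=
      hasProjectiveDimensionLT_of_exact (precomp_g_injective hS (ModuleCat.of A A))
        (exact_precomp_g_precomp_f hS (ModuleCat.of A A) 0) (fun x =>
          (exact_precomp_f_precomp_extClass hS (ModuleCat.of A A) 0 x).mp
            ((h 1 (by omega) (by omega)).elim _ _)) hd
        (hasProjectiveDimensionLT_ext_zero (ModuleCat.of A (Fin k → A)) d)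
    have := ih (d + 1) f.shortComplexKer.X₁ hK₁ (fun i h0 hi => by
      obtain ⟨j, rfl⟩ : ∃ j, i = j + 1 := ⟨i - 1, by omega⟩
      exact @Equiv.subsingleton _ _ (e j).toEquiv (h (j + 2) (by omega) (by omega))) hd₁
    rw [show d + (m + 1) + 2 = d + 1 + m + 2 by omega]
    exact hasProjectiveDimensionLT_of_iso (e m).toModuleIso _

/-- If `L` is perfect of grade `n`, then `Ext^n(L, A)` has projective dimension at most `n`. -/
theorem hasProjectiveDimensionLT_ext_of_perfect [IsNoetherianRing A] (n : ℕ) (L : ModuleCat.{u} A)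
    [Module.Finite A L] (hL : HasProjectiveDimensionLT L (n + 1))
    (h : ∀ i < n, Subsingleton (Ext L (ModuleCat.of A A) i)) :
    HasProjectiveDimensionLT (ModuleCat.of A (Ext L (ModuleCat.of A A) n)) (n + 1) := by
  cases n with
  | zero =>
    have : Module.Projective A L := (IsProjective.iff_projective _).mpr
      (projective_iff_hasProjectiveDimensionLT_one.mpr hL)
    exact hasProjectiveDimensionLT_ext_zero L 0
  | succ m =>
    have := hasProjectiveDimensionLT_ext m 0 L hL (fun i _ hi => h i hi)
      ((hasProjectiveDimensionLT_zero_iff_isZero _).mpr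
        (ModuleCat.isZero_iff_subsingleton.mpr (h 0 (by omega))))
    rwa [zero_add] at this

end DimensionShifting

/-! ### Change of rings along a quasi-deformation -/

/-- An isomorphism of cokernels. -/
lemma nonempty_linearEquiv_of_exact {A : Type*} [Ring A] {X Y Z X' Y' Z' : Type*}
    [AddCommGroup X] [AddCommGroup Y] [AddCommGroup Z] [AddCommGroup X'] [AddCommGroup Y']
    [AddCommGroup Z'] [Module A X] [Module A Y] [Module A Z] [Module A X'] [Module A Y']
    [Module A Z'] {f : X →ₗ[A] Y} {g : Y →ₗ[A] Z} {f' : X' →ₗ[A] Y'} {g' : Y' →ₗ[A] Z'}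
    (hfg : Function.Exact f g) (hg : Function.Surjective g)
    (hfg' : Function.Exact f' g') (hg' : Function.Surjective g')
    (eX : X ≃ₗ[A] X') (eY : Y ≃ₗ[A] Y') (comm : ∀ x, eY (f x) = f' (eX x)) :
    Nonempty (Z ≃ₗ[A] Z') := by
  have hker : (LinearMap.ker g).map (eY : Y →ₗ[A] Y') = LinearMap.ker g' := by
    rw [LinearMap.exact_iff.mp hfg, LinearMap.exact_iff.mp hfg', ← LinearMap.range_comp,
      show (eY : Y →ₗ[A] Y') ∘ₗ f = f' ∘ₗ (eX : X →ₗ[A] X') from LinearMap.ext comm,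
      LinearMap.range_comp, LinearEquiv.range, Submodule.map_top]
  exact ⟨(g.quotKerEquivOfSurjective hg).symm.trans
    ((Submodule.Quotient.equiv _ _ eY hker).trans (g'.quotKerEquivOfSurjective hg'))⟩

namespace QuasiDeformation

variable {R : Type u} [CommRing R] (D : QuasiDeformation R)

/-- `S ⊗[R] -` as a functor to modules over `Q`, on objects. -/
noncomputable abbrev tensorObj (M : Type u) [AddCommGroup M] [Module R M] : ModuleCat.{u} D.Q :=
  ModuleCat.of D.Q (D.S ⊗[R] M)

/-- `S ⊗[R] -` as a functor to modules over `Q`, on morphisms. -/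
noncomputable abbrev tensorMap {M N : Type u} [AddCommGroup M] [Module R M] [AddCommGroup N]
    [Module R N] (f : M →ₗ[R] N) : D.S ⊗[R] M →ₗ[D.Q] D.S ⊗[R] N :=
  (f.baseChange D.S).restrictScalars D.Q

/-- `S ⊗[R] -` as a functor to modules over `Q`, on isomorphisms. -/
noncomputable abbrev tensorEquiv {M N : Type u} [AddCommGroup M] [Module R M] [AddCommGroup N]
    [Module R N] (e : M ≃ₗ[R] N) : D.S ⊗[R] M ≃ₗ[D.Q] D.S ⊗[R] N :=
  (e.baseChange R D.S M N).restrictScalars D.Q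

/-- As `Q → S` is surjective, `Q`-linear maps between `S`-modules are `S`-linear. -/
noncomputable def restrictScalarsEquiv (X Y : Type u) [AddCommGroup X] [AddCommGroup Y]
    [Module D.S X] [Module D.S Y] [Module D.Q X] [Module D.Q Y] [IsScalarTower D.Q D.S X]
    [IsScalarTower D.Q D.S Y] : (X →ₗ[D.S] Y) ≃ₗ[D.Q] (X →ₗ[D.Q] Y) where
  toFun f := f.restrictScalars D.Q
  map_add' _ _ := rfl
  map_smul' _ _ := rfl
  invFun f :=
    { f with
      map_smul' s x := by
        obtain ⟨q, rfl⟩ := D.surjective s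
        simp }
  left_inv _ := rfl
  right_inv _ := rfl

/-- `S ⊗ Hom_R(M, R) ≃ Hom_Q(S ⊗ M, S)` for finitely generated `M`, by flatness of `S`. -/
noncomputable def tensorHomEquiv [IsNoetherianRing R] (M : Type u) [AddCommGroup M] [Module R M]
    [Module.Finite R M] :
    D.S ⊗[R] (M →ₗ[R] R) ≃ₗ[D.Q] (D.S ⊗[R] M →ₗ[D.Q] D.S ⊗[R] R) :=
  have := Module.finitePresentation_of_finite R M
  ((Module.FinitePresentation.isBaseChange_map R M R D.S).equiv.restrictScalars D.Q).trans
    (D.restrictScalarsEquiv _ _)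

lemma tensorHomEquiv_tmul [IsNoetherianRing R] {M : Type u} [AddCommGroup M] [Module R M]
    [Module.Finite R M] (s : D.S) (f : M →ₗ[R] R) (x : D.S ⊗[R] M) :
    D.tensorHomEquiv M (s ⊗ₜ f) x = s • f.baseChange D.S x := by
  have := Module.finitePresentation_of_finite R M
  change (Module.FinitePresentation.isBaseChange_map R M R D.S).equiv (s ⊗ₜ f) x = _
  rw [IsBaseChange.equiv_tmul]
  rfl

lemma tensorHomEquiv_naturality [IsNoetherianRing R] {M N : Type u} [AddCommGroup M] [Module R M]
    [Module.Finite R M] [AddCommGroup N] [Module R N] [Module.Finite R N] (f : M →ₗ[R] N)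
    (z : D.S ⊗[R] (N →ₗ[R] R)) :
    D.tensorHomEquiv M ((f.lcomp R R).baseChange D.S z) =
      D.tensorHomEquiv N z ∘ₗ D.tensorMap f := by
  induction z with
  | zero => simp
  | add x y hx hy => rw [map_add, map_add, hx, hy, map_add, LinearMap.add_comp]
  | tmul s h =>
    ext x
    simp only [LinearMap.baseChange_tmul, tensorHomEquiv_tmul, LinearMap.comp_apply,
      LinearMap.restrictScalars_apply]
    congr 1
    exact LinearMap.congr_fun (LinearMap.baseChange_comp (A := D.S) f h) x

lemma mem_annihilator_tensor {rs : List D.Q}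
    (hker : RingHom.ker (algebraMap D.Q D.S) = Ideal.ofList rs) (M : Type u) [AddCommGroup M]
    [Module R M] : ∀ r ∈ rs, r ∈ Module.annihilator D.Q (D.S ⊗[R] M) := by
  intro r hr
  have hr0 : algebraMap D.Q D.S r = 0 := by
    rw [← RingHom.mem_ker, hker]
    exact Ideal.subset_span hr
  refine Module.mem_annihilator.mpr fun x => ?_
  rw [← algebraMap_smul D.S r x, hr0, zero_smul]

/-- `S ⊗[R] R` is the quotient of `Q` by the regular sequence. -/
noncomputable def tensorSelfEquiv {rs : List D.Q}
    (hker : RingHom.ker (algebraMap D.Q D.S) = Ideal.ofList rs) :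
    D.S ⊗[R] R ≃ₗ[D.Q] D.Q ⧸ (Ideal.ofList rs • (⊤ : Submodule D.Q D.Q)) :=
  ((AlgebraTensorModule.rid R D.S D.S).restrictScalars D.Q).trans
    (((Algebra.linearMap D.Q D.S).quotKerEquivOfSurjective D.surjective).symm.trans
      (Submodule.quotEquivOfEq _ _ (by
        rw [smul_eq_mul, Ideal.mul_top, ← hker]
        rfl)))

/-- The universal class of `exists_ext_comp_bijective`, transported to `S ⊗[R] R`: composition with
it identifies `Hom_Q(S ⊗ M, S)` with `Ext^c_Q(S ⊗ M, Q)`. -/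
lemma exists_tensor_ext_comp_bijective {rs : List D.Q} (hrs : IsWeaklyRegular D.Q rs)
    (hker : RingHom.ker (algebraMap D.Q D.S) = Ideal.ofList rs) :
    ∃ η : Ext (D.tensorObj R) (ModuleCat.of D.Q D.Q) rs.length,
      ∀ (M : Type u) [AddCommGroup M] [Module R M],
        Function.Bijective (η.postcompOfLinear D.Q (D.tensorObj M) (zero_add rs.length)) := by
  obtain ⟨η, hη⟩ := exists_ext_comp_bijective rs (ModuleCat.of D.Q D.Q) hrs
  let e := (D.tensorSelfEquiv hker).toModuleIso
  refine ⟨(Ext.mk₀ e.hom).comp η (zero_add _), fun M _ _ => ?_⟩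
  have h := (hη (D.tensorObj M) (D.mem_annihilator_tensor hker M)).comp
    ((bijective_comp_iso_hom (D.tensorObj M) e).comp Ext.homEquiv₀.bijective)
  convert h using 1
  funext x
  obtain ⟨f, rfl⟩ := (Ext.mk₀_bijective _ _).2 x
  simp [Ext.homEquiv₀]

/-- Composing `tensorHomEquiv` with a universal class `η` compares `Hom_R(M, R)` after base change
to `S` with `Ext^c_Q(S ⊗ M, Q)`. -/
noncomputable def tensorExtZeroEquiv [IsNoetherianRing R] {c : ℕ}
    {η : Ext (D.tensorObj R) (ModuleCat.of D.Q D.Q) c}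
    (hη : ∀ (M : Type u) [AddCommGroup M] [Module R M],
      Function.Bijective (η.postcompOfLinear D.Q (D.tensorObj M) (zero_add c)))
    (M : Type u) [AddCommGroup M] [Module R M] [Module.Finite R M] :
    D.S ⊗[R] Ext (ModuleCat.of R M) (ModuleCat.of R R) 0 ≃ₗ[D.Q]
      Ext (D.tensorObj M) (ModuleCat.of D.Q D.Q) c :=
  (D.tensorEquiv ((Ext.linearEquiv₀ (R := R)).trans ModuleCat.homLinearEquiv)).trans
    ((D.tensorHomEquiv M).trans
      (((Ext.linearEquiv₀ (R := D.Q)).trans ModuleCat.homLinearEquiv).symm.trans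
        (LinearEquiv.ofBijective _ (hη M))))

lemma tensorExtZeroEquiv_naturality [IsNoetherianRing R] {c : ℕ}
    {η : Ext (D.tensorObj R) (ModuleCat.of D.Q D.Q) c}
    (hη : ∀ (M : Type u) [AddCommGroup M] [Module R M],
      Function.Bijective (η.postcompOfLinear D.Q (D.tensorObj M) (zero_add c)))
    {M N : Type u} [AddCommGroup M] [Module R M] [Module.Finite R M] [AddCommGroup N] [Module R N]
    [Module.Finite R N] (f : M →ₗ[R] N)
    (z : D.S ⊗[R] Ext (ModuleCat.of R N) (ModuleCat.of R R) 0) :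
    D.tensorExtZeroEquiv hη M (D.tensorMap
        ((Ext.mk₀ (ModuleCat.ofHom f)).precompOfLinear R (ModuleCat.of R R) (zero_add 0)) z) =
      (Ext.mk₀ (ModuleCat.ofHom (D.tensorMap f))).precompOfLinear D.Q (ModuleCat.of D.Q D.Q)
        (zero_add c) (D.tensorExtZeroEquiv hη N z) := by
  have h1 : D.tensorEquiv ((Ext.linearEquiv₀ (R := R)).trans ModuleCat.homLinearEquiv)
      (D.tensorMap ((Ext.mk₀ (ModuleCat.ofHom f)).precompOfLinear R (ModuleCat.of R R)
        (zero_add 0)) z) =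
      (f.lcomp R R).baseChange D.S
        (D.tensorEquiv ((Ext.linearEquiv₀ (R := R)).trans ModuleCat.homLinearEquiv) z) := by
    induction z with
    | zero => simp only [map_zero]
    | add x y hx hy => simp only [map_add, hx, hy]
    | tmul s h =>
      have key : ((Ext.linearEquiv₀ (R := R)).trans ModuleCat.homLinearEquiv)
          ((Ext.mk₀ (ModuleCat.ofHom f)).precompOfLinear R (ModuleCat.of R R) (zero_add 0) h) =
          f.lcomp R R (((Ext.linearEquiv₀ (R := R)).trans ModuleCat.homLinearEquiv) h) := by
        obtain ⟨h, rfl⟩ := (Ext.linearEquiv₀ (R := R)).symm.surjective h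
        have hc : (Ext.mk₀ (ModuleCat.ofHom f)).precompOfLinear R (ModuleCat.of R R) (zero_add 0)
            ((Ext.linearEquiv₀ (R := R)).symm h) =
            (Ext.linearEquiv₀ (R := R)).symm (ModuleCat.ofHom f ≫ h) :=
          Ext.mk₀_comp_mk₀ _ _
        rw [hc, LinearEquiv.trans_apply, LinearEquiv.trans_apply, LinearEquiv.apply_symm_apply,
          LinearEquiv.apply_symm_apply]
        rfl
      exact congrArg (fun φ => s ⊗ₜ[R] φ) key
  have h2 (g : D.S ⊗[R] N →ₗ[D.Q] D.S ⊗[R] R) :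
      η.postcompOfLinear D.Q (D.tensorObj M) (zero_add c) (Ext.mk₀ (ModuleCat.ofHom
          (g ∘ₗ D.tensorMap f))) =
        (Ext.mk₀ (ModuleCat.ofHom (D.tensorMap f))).precompOfLinear D.Q (ModuleCat.of D.Q D.Q)
          (zero_add c) (η.postcompOfLinear D.Q (D.tensorObj N) (zero_add c)
            (Ext.mk₀ (ModuleCat.ofHom g))) := by
    simp [ModuleCat.ofHom_comp, ← Ext.mk₀_comp_mk₀_assoc]
  have h3 := D.tensorHomEquiv_naturality f
    (D.tensorEquiv ((Ext.linearEquiv₀ (R := R)).trans ModuleCat.homLinearEquiv) z)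
  rw [← h1] at h3
  exact (congrArg (fun g => η.postcompOfLinear D.Q (D.tensorObj M) (zero_add c)
    (Ext.mk₀ (ModuleCat.ofHom g))) h3).trans (h2 _)

/-- The image of `0 → ker f → M → N → 0` under `S ⊗[R] -`, as a sequence of `Q`-modules. -/
noncomputable def tensorKerShortComplex {M N : Type u} [AddCommGroup M] [Module R M]
    [AddCommGroup N] [Module R N] (f : M →ₗ[R] N) : ShortComplex (ModuleCat.{u} D.Q) :=
  ShortComplex.mk (X₁ := D.tensorObj (LinearMap.ker f)) (X₂ := D.tensorObj M)
    (X₃ := D.tensorObj N) (ModuleCat.ofHom (D.tensorMap (LinearMap.ker f).subtype))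
    (ModuleCat.ofHom (D.tensorMap f)) (by
      ext x
      have h : f ∘ₗ (LinearMap.ker f).subtype = 0 := by ext; simp
      have := LinearMap.congr_fun
        (LinearMap.baseChange_comp (A := D.S) (LinearMap.ker f).subtype f) x
      rw [h, LinearMap.baseChange_zero] at this
      exact this.symm)

lemma tensorKerShortComplex_shortExact {M N : Type u} [AddCommGroup M] [Module R M]
    [AddCommGroup N] [Module R N] {f : M →ₗ[R] N} (hf : Function.Surjective f) :
    (D.tensorKerShortComplex f).ShortExact :=
  ModuleCat.shortComplex_shortExact _
    (lTensor_exact D.S (LinearMap.exact_subtype_ker_map f) hf)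
    (Module.Flat.lTensor_preserves_injective_linearMap _ (LinearMap.ker f).injective_subtype)
    (LinearMap.lTensor_surjective D.S hf)

lemma projectiveDimension_tensor_self {rs : List D.Q} (hrs : IsRegular D.Q rs)
    (hker : RingHom.ker (algebraMap D.Q D.S) = Ideal.ofList rs) :
    projectiveDimension (D.tensorObj R) = rs.length := by
  rw [← ModuleCat.projectiveDimension_quotient_eq_length.{u} rs hrs]
  have e : (D.Q ⧸ (Ideal.ofList rs • (⊤ : Submodule D.Q D.Q))) ≃ₗ[D.Q] (D.Q ⧸ Ideal.ofList rs) :=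
    Submodule.quotEquivOfEq _ _ (by rw [smul_eq_mul, Ideal.mul_top])
  exact projectiveDimension_eq_of_iso
    (((D.tensorSelfEquiv hker).trans e).trans (Shrink.linearEquiv D.Q _).symm).toModuleIso

lemma subsingleton_ext_tensor_free {n : ℕ}
    (h : Subsingleton (Ext (D.tensorObj R) (ModuleCat.of D.Q D.Q) n)) (k : ℕ) :
    Subsingleton (Ext (D.tensorObj (Fin k → R)) (ModuleCat.of D.Q D.Q) n) := by
  refine subsingleton_of_forall_eq 0 fun x => ?_
  have hid : 𝟙 (D.tensorObj (Fin k → R)) = ∑ i : Fin k,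
      (ModuleCat.ofHom (D.tensorMap (LinearMap.proj i : (Fin k → R) →ₗ[R] R)) :
          D.tensorObj (Fin k → R) ⟶ D.tensorObj R) ≫
        ModuleCat.ofHom (D.tensorMap (LinearMap.single R (fun _ : Fin k => R) i)) := by
    apply ModuleCat.hom_ext
    rw [ModuleCat.hom_sum]
    refine LinearMap.ext fun z => ?_
    rw [LinearMap.sum_apply]
    change z = ∑ i : Fin k, (LinearMap.single R (fun _ : Fin k => R) i).baseChange D.S
      ((LinearMap.proj i : (Fin k → R) →ₗ[R] R).baseChange D.S z)
    change D.S ⊗[R] (Fin k → R) at z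
    induction z with
    | zero => simp
    | add x y hx hy =>
      simp only [map_add, Finset.sum_add_distrib]
      rw [← hx, ← hy]
    | tmul s v =>
      simp only [LinearMap.baseChange_tmul, LinearMap.coe_proj, Function.eval,
        LinearMap.coe_single, ← TensorProduct.tmul_sum]
      rw [Finset.univ_sum_single v]
  rw [← Ext.mk₀_id_comp x, hid, Ext.mk₀_sum, Ext.sum_comp]
  refine Finset.sum_eq_zero fun i _ => ?_
  have h0 : (Ext.mk₀ (ModuleCat.ofHom (D.tensorMap
      (LinearMap.single R (fun _ : Fin k => R) i)))).comp x (zero_add n) = 0 := h.elim _ _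
  rw [← Ext.mk₀_comp_mk₀, Ext.comp_assoc_of_second_deg_zero, h0, Ext.comp_zero]

/-- Flat base change along `R → S` combined with Rees's change of rings along `Q → S`:
`S ⊗ Ext^i_R(M, R) ≃ Ext^{c+i}_Q(S ⊗ M, Q)`. In degree zero this is `tensorExtZeroEquiv`; its
naturality gives degree one, as both sides are cokernels, and dimension shifting gives the rest. -/
theorem nonempty_tensor_ext_equiv [IsNoetherianRing R] {rs : List D.Q} (hrs : IsRegular D.Q rs)
    (hker : RingHom.ker (algebraMap D.Q D.S) = Ideal.ofList rs) (i : ℕ) (M : Type u)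
    [AddCommGroup M] [Module R M] [Module.Finite R M] :
    Nonempty (D.S ⊗[R] ExtRing R M i ≃ₗ[D.Q]
      Ext (D.tensorObj M) (ModuleCat.of D.Q D.Q) (rs.length + i)) := by
  obtain ⟨η, hη⟩ := D.exists_tensor_ext_comp_bijective hrs.toIsWeaklyRegular hker
  have hself : HasProjectiveDimensionLT (D.tensorObj R) (rs.length + 1) :=
    (projectiveDimension_le_iff _ _).mp (D.projectiveDimension_tensor_self hrs hker).le
  have hfree (k n : ℕ) (hn : rs.length + 1 ≤ n) :=
    D.subsingleton_ext_tensor_free (hself.subsingleton _ _ n hn (ModuleCat.of D.Q D.Q)) k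
  induction i using Nat.strong_induction_on generalizing M with
  | _ i ih =>
    match i with
    | 0 => exact ⟨D.tensorExtZeroEquiv hη M⟩
    | i + 1 =>
      obtain ⟨k, f, hf⟩ := Module.Finite.exists_fin' R M
      have hS := LinearMap.shortExact_shortComplexKer hf
      have : Projective (ModuleCat.of R (Fin k → R)) := inferInstance
      have hT := D.tensorKerShortComplex_shortExact hf
      match i with
      | 0 =>
        exact nonempty_linearEquiv_of_exact
          (f := D.tensorMap ((Ext.mk₀ f.shortComplexKer.f).precompOfLinear R (ModuleCat.of R R)
            (zero_add 0)))
          (g := D.tensorMap (hS.extClass.precompOfLinear R (ModuleCat.of R R) (add_comm 1 0)))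
          (lTensor_exact D.S (exact_precomp_f_precomp_extClass hS (ModuleCat.of R R) 0)
            (precomp_extClass_surjective hS _ 0 (Ext.subsingleton_of_projective _ _ 0)))
          (LinearMap.lTensor_surjective D.S
            (precomp_extClass_surjective hS _ 0 (Ext.subsingleton_of_projective _ _ 0)))
          (exact_precomp_f_precomp_extClass hT (ModuleCat.of D.Q D.Q) rs.length)
          (precomp_extClass_surjective hT _ rs.length (hfree k _ le_rfl))
          (D.tensorExtZeroEquiv hη (Fin k → R)) (D.tensorExtZeroEquiv hη (LinearMap.ker f))
          (D.tensorExtZeroEquiv_naturality hη (LinearMap.ker f).subtype)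
      | i + 1 =>
        obtain ⟨e⟩ := ih (i + 1) (by omega) (LinearMap.ker f)
        exact ⟨((D.tensorEquiv (extDimensionShift hS (ModuleCat.of R R) (i + 1)
          (Ext.subsingleton_of_projective _ _ i)
          (Ext.subsingleton_of_projective _ _ (i + 1)))).symm.trans e).trans
            (extDimensionShift hT (ModuleCat.of D.Q D.Q) (rs.length + (i + 1))
              (hfree k _ (by omega)) (hfree k _ (by omega)))⟩

end QuasiDeformation

/-! ### Projective dimension and grade as extended numbers -/

lemma coe_toENNReal_natCast (m : ℕ) : ((((m : ℕ) : ℕ∞) : ENNReal) : EReal) = (m : EReal) := by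
  rw [ENat.toENNReal_coe]
  rfl

lemma natCast_le_extendedPd_iff {A : Type u} [CommRing A] {N : Type u} [AddCommGroup N]
    [Module A N] (n : ℕ) :
    (n : EReal) ≤ extendedPd A N ↔ (n : WithBot ℕ∞) ≤ projectiveDimension (ModuleCat.of A N) := by
  unfold extendedPd
  generalize projectiveDimension (ModuleCat.of A N) = d
  match d with
  | ⊥ =>
    refine iff_of_false (fun h => ?_) (fun h => ?_)
    · exact EReal.natCast_ne_bot n (le_bot_iff.mp h)
    · exact absurd (le_bot_iff.mp h) (by simp)
  | (⊤ : ℕ∞) => simp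
  | ((m : ℕ) : ℕ∞) =>
    change (n : EReal) ≤ ((((m : ℕ) : ℕ∞) : ENNReal) : EReal) ↔
      (((n : ℕ∞) : WithBot ℕ∞)) ≤ (((m : ℕ) : ℕ∞) : WithBot ℕ∞)
    rw [coe_toENNReal_natCast, WithBot.coe_le_coe, Nat.cast_le]
    norm_cast

lemma extendedPd_le_natCast_iff {A : Type u} [CommRing A] {N : Type u} [AddCommGroup N]
    [Module A N] (n : ℕ) :
    extendedPd A N ≤ (n : EReal) ↔ projectiveDimension (ModuleCat.of A N) ≤ (n : WithBot ℕ∞) := by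
  unfold extendedPd
  generalize projectiveDimension (ModuleCat.of A N) = d
  match d with
  | ⊥ => simp
  | (⊤ : ℕ∞) =>
    refine iff_of_false (fun h => ?_) (fun h => ?_)
    · exact EReal.natCast_ne_top n (top_le_iff.mp (by simpa using h))
    · exact absurd (WithBot.coe_le_coe.mp h) (by simp)
  | ((m : ℕ) : ℕ∞) =>
    change ((((m : ℕ) : ℕ∞) : ENNReal) : EReal) ≤ (n : EReal) ↔
      (((m : ℕ) : ℕ∞) : WithBot ℕ∞) ≤ (((n : ℕ∞) : WithBot ℕ∞))
    rw [coe_toENNReal_natCast, WithBot.coe_le_coe, Nat.cast_le]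
    norm_cast

lemma EReal.natCast_add_sub_natCast (c n : ℕ) : (((c + n : ℕ) : EReal) - (c : EReal)) = n := by
  have h (k : ℕ) : (k : EReal) = ((k : ℝ) : EReal) := rfl
  rw [h, h, h, ← EReal.coe_sub]
  congr 1
  push_cast
  ring

lemma moduleGrade_eq_natCast_iff {R : Type u} [CommRing R] {M : Type u} [AddCommGroup M]
    [Module R M] {g : ℕ} :
    moduleGrade R M = g ↔
      Nontrivial (ExtRing R M g) ∧ ∀ i < g, Subsingleton (ExtRing R M i) := by
  constructor
  · intro h
    have hlow (i : ℕ) (hi : i < g) : Subsingleton (ExtRing R M i) := by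
      rw [← not_nontrivial_iff_subsingleton]
      intro hn
      have h1 : moduleGrade R M ≤ i := iInf₂_le i hn
      rw [h, Nat.cast_le] at h1
      omega
    refine ⟨?_, hlow⟩
    by_contra hn
    rw [not_nontrivial_iff_subsingleton] at hn
    have h1 : ((g + 1 : ℕ) : ℕ∞) ≤ moduleGrade R M := le_iInf₂ fun i hi => by
      rw [Nat.cast_le]
      by_contra hlt
      rcases Nat.lt_or_ge i g with h' | h'
      · exact not_subsingleton_iff_nontrivial.mpr hi (hlow i h')
      · obtain rfl : i = g := by omega
        exact not_subsingleton_iff_nontrivial.mpr hi hn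
    rw [h, Nat.cast_le] at h1
    omega
  · rintro ⟨hg, hlow⟩
    refine le_antisymm (iInf₂_le g hg) (le_iInf₂ fun i hi => ?_)
    rw [Nat.cast_le]
    by_contra hlt
    exact not_subsingleton_iff_nontrivial.mpr hi (hlow i (by omega))

/-! ### Grade along a quasi-deformation -/

namespace QuasiDeformation

variable {R : Type u} [CommRing R] (D : QuasiDeformation R)

lemma extendedPd_eq_length {rs : List D.Q} (hrs : IsRegular D.Q rs)
    (hker : RingHom.ker (algebraMap D.Q D.S) = Ideal.ofList rs) :
    extendedPd D.Q D.S = rs.length := by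
  have h : projectiveDimension (ModuleCat.of D.Q D.S) = rs.length := by
    rw [← D.projectiveDimension_tensor_self hrs hker]
    exact projectiveDimension_eq_of_iso
      ((AlgebraTensorModule.rid R D.S D.S).restrictScalars D.Q).symm.toModuleIso
  exact le_antisymm ((extendedPd_le_natCast_iff _).mpr h.le)
    ((natCast_le_extendedPd_iff _).mpr h.ge)

lemma finite_tensor (M : Type u) [AddCommGroup M] [Module R M] [Module.Finite R M] :
    Module.Finite D.Q (D.S ⊗[R] M) :=
  have : Module.Finite D.Q D.S := .of_surjective (Algebra.linearMap D.Q D.S) D.surjective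
  .trans D.S _

lemma nontrivial_tensor_iff [IsLocalRing R] (X : Type u) [AddCommGroup X] [Module R X] :
    Nontrivial (D.S ⊗[R] X) ↔ Nontrivial X := by
  have : Module.FaithfullyFlat R D.S := Module.FaithfullyFlat.of_flat_of_isLocalHom
  rw [← not_subsingleton_iff_nontrivial, ← not_subsingleton_iff_nontrivial,
    Module.FaithfullyFlat.subsingleton_tensorProduct_iff_right R D.S]

variable [IsLocalRing R] [IsNoetherianRing R]

lemma nontrivial_ext_tensor_iff {rs : List D.Q} (hrs : IsRegular D.Q rs)
    (hker : RingHom.ker (algebraMap D.Q D.S) = Ideal.ofList rs) (i : ℕ) (M : Type u)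
    [AddCommGroup M] [Module R M] [Module.Finite R M] :
    Nontrivial (Ext (D.tensorObj M) (ModuleCat.of D.Q D.Q) (rs.length + i)) ↔
      Nontrivial (ExtRing R M i) := by
  obtain ⟨e⟩ := D.nonempty_tensor_ext_equiv hrs hker i M
  rw [← D.nontrivial_tensor_iff (ExtRing R M i)]
  exact e.toEquiv.nontrivial_congr.symm

/-- The grade of `S ⊗[R] M` over `Q` is `grade M + c`, where `c` is the length of the regular
sequence. -/
lemma moduleGrade_eq_iff_tensor {rs : List D.Q} (hrs : IsRegular D.Q rs)
    (hker : RingHom.ker (algebraMap D.Q D.S) = Ideal.ofList rs) (g : ℕ) (M : Type u)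
    [AddCommGroup M] [Module R M] [Module.Finite R M] :
    moduleGrade R M = g ↔
      Nontrivial (Ext (D.tensorObj M) (ModuleCat.of D.Q D.Q) (rs.length + g)) ∧
      ∀ i < rs.length + g, Subsingleton (Ext (D.tensorObj M) (ModuleCat.of D.Q D.Q) i) := by
  rw [moduleGrade_eq_natCast_iff, D.nontrivial_ext_tensor_iff hrs hker]
  refine and_congr_right fun _ => ⟨fun h i hi => ?_, fun h i hi => ?_⟩
  · rcases Nat.lt_or_ge i rs.length with h' | h'
    · exact subsingleton_ext_of_isWeaklyRegular rs _ hrs.toIsWeaklyRegular _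
        (D.mem_annihilator_tensor hker M) i h'
    · obtain ⟨j, rfl⟩ := Nat.exists_eq_add_of_le h'
      rw [← not_nontrivial_iff_subsingleton, D.nontrivial_ext_tensor_iff hrs hker,
        not_nontrivial_iff_subsingleton]
      exact h j (by omega)
  · rw [← not_nontrivial_iff_subsingleton, ← D.nontrivial_ext_tensor_iff hrs hker,
      not_nontrivial_iff_subsingleton]
    exact h _ (by omega)

end QuasiDeformation

/-- The complete intersection dimension is at least the grade. -/
lemma le_ciDim_of_nontrivial_ext {R : Type u} [CommRing R] [IsLocalRing R] [IsNoetherianRing R]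
    {M : Type u} [AddCommGroup M] [Module R M] [Module.Finite R M] {g : ℕ}
    (hg : Nontrivial (ExtRing R M g)) : (g : EReal) ≤ ciDim R M := by
  refine le_iInf fun D => ?_
  obtain ⟨rs, hrs, hker⟩ := D.exists_regular
  rw [D.extendedPd_eq_length hrs hker, ← EReal.natCast_add_sub_natCast rs.length g]
  refine EReal.sub_le_sub ((natCast_le_extendedPd_iff _).mpr ?_) le_rfl
  rw [projectiveDimension_ge_iff]
  intro h
  have h1 := h.subsingleton _ _ _ le_rfl (ModuleCat.of D.Q D.Q)
  have h2 := (D.nontrivial_ext_tensor_iff hrs hker g M).mpr hg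
  exact not_subsingleton_iff_nontrivial.mpr h2 h1

/-! ### Duality for CI-perfect modules -/

theorem mainTheorem4 (R : Type u) [CommRing R] [IsLocalRing R] [IsNoetherianRing R]
    (M : Type u) [AddCommGroup M] [Module R M] [Module.Finite R M] (g : ℕ)
    (hM : IsCIPerfectOfGrade R M g) :
    IsCIPerfectOfGrade R (ExtRing R M g) g := by
  obtain ⟨hci, hgrade⟩ := hM
  unfold IsCIPerfect at hci
  rw [hgrade, coe_toENNReal_natCast] at hci
  have hfin : Module.Finite R (ExtRing R M g) := ModuleCat.finite_ext R _ _ g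
  have hlt : ciDim R M < ((g + 1 : ℕ) : EReal) := by
    rw [hci]
    exact_mod_cast Nat.lt_succ_self g
  -- All values in the infimum are integers or infinite, so some quasi-deformation attains it.
  obtain ⟨D, hD⟩ := iInf_lt_iff.mp hlt
  obtain ⟨rs, hrs, hker⟩ := D.exists_regular
  rw [D.extendedPd_eq_length hrs hker] at hD
  have hpd : HasProjectiveDimensionLT (D.tensorObj M) (rs.length + g + 1) := by
    by_contra hn
    rw [← projectiveDimension_ge_iff, ← natCast_le_extendedPd_iff] at hn
    refine hD.not_ge ?_
    rw [← EReal.natCast_add_sub_natCast rs.length (g + 1)]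
    exact EReal.sub_le_sub hn le_rfl
  obtain ⟨hnt, hlow⟩ := (D.moduleGrade_eq_iff_tensor hrs hker g M).mp hgrade
  have := D.finite_tensor M
  have := D.finite_tensor (ExtRing R M g)
  obtain ⟨e⟩ := D.nonempty_tensor_ext_equiv hrs hker g M
  -- `S ⊗ Ext^g_R(M, R)` is the top `Ext` of the perfect `Q`-module `S ⊗ M`, hence perfect itself.
  have := e.toEquiv.nontrivial
  have hpd' : HasProjectiveDimensionLT (D.tensorObj (ExtRing R M g)) (rs.length + g + 1) :=
    have := hasProjectiveDimensionLT_ext_of_perfect (rs.length + g) (D.tensorObj M) hpd hlow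
    hasProjectiveDimensionLT_of_iso e.symm.toModuleIso _
  have hlow' : ∀ i < rs.length + g,
      Subsingleton (Ext (D.tensorObj (ExtRing R M g)) (ModuleCat.of D.Q D.Q) i) := fun i hi =>
    subsingleton_ext_of_annihilator_le hlow (fun r hr => Module.mem_annihilator.mpr fun x =>
      e.injective (by
        rw [map_smul, map_zero]
        exact ext_smul_eq_zero_of_mem_annihilator_left hr (e x))) hi
  have hnt' := nontrivial_ext_of_hasProjectiveDimensionLT hpd' hlow'
  have hgrade' := (D.moduleGrade_eq_iff_tensor hrs hker g (ExtRing R M g)).mpr ⟨hnt', hlow'⟩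
  refine ⟨?_, hgrade'⟩
  unfold IsCIPerfect
  rw [hgrade', coe_toENNReal_natCast]
  refine le_antisymm ((iInf_le _ D).trans ?_)
    (le_ciDim_of_nontrivial_ext (moduleGrade_eq_natCast_iff.mp hgrade').1)
  rw [D.extendedPd_eq_length hrs hker, ← EReal.natCast_add_sub_natCast rs.length g]
  exact EReal.sub_le_sub ((extendedPd_le_natCast_iff _).mpr
    ((projectiveDimension_le_iff _ _).mpr hpd')) le_rfl
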